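/- There is a universal constant $c_{\mathrm{par}}>0$, admissible in Lévy's inequality on all unit spheres (that is, for every $M\ge 1$, every $L$-Lipschitz $f:S^{M-1}\to\mathbb R$ with $L>0$ and every $\tau>0$, $\Pr_{\theta\sim\mu_S}(|f(\theta)-\mathbb E_{\mu_S}f|\ge\tau)\le 2\exp(-c_{\mathrm{par}}M\tau^2/L^2)$, where $\mu_S$ is the uniform probability measure on $S^{M-1}=\{\theta\in\mathbb R^M:\|\theta\|_2=1\}$ and Lipschitz refers to the Euclidean distance), such that the following holds. Let $\mathcal H$ be a finite-dimensional complex Hilbert space. A GKSL generator is a linear map $\mathcal L$ on $\mathcal B(\mathcal H)$ that preserves Hermiticity, satisfies $\operatorname{Tr}\mathcal L(A)=0$ for all $A$, and for which $e^{s\mathcal L}$ is completely positive and trace preserving for all $s\ge 0$. Let $\mathcal L_{\mathrm{ref}}$ be a GKSL generator, $G_1,\dots,G_M$ linear maps on $\mathcal B(\mathcal H)$ with $\|G_j\|_{1\to1}\le C_G$ for all $j$ (norm induced by the trace norm), $C_G>0$, $\delta>0$, and $$\mathcal L(\theta)=\mathcal L_{\mathrm{ref}}+\frac{\delta}{\sqrt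 M}\sum_{j=1}^M\theta_jG_j .$$ Let $\Theta\subseteq S^{M-1}$ be nonempty with $\mathcal L(\theta)$ a GKSL generator for all $\theta\in\Theta$, and let $\mu_\Theta$ be the normalized restriction of $\mu_S$ to $\Theta$. Fix $t>0$, a density operator $\rho_{\mathrm{in}}$, a POVM $\{M_x\}_{x\in X}$ with $X$ finite, and a probability distribution $Q$ on $X$. Put $P_{\mathcal L}(x)=\operatorname{Tr}\bigl(M_x e^{t\mathcal L}(\rho_{\mathrm{in}})\bigr)$, $d_{\mathrm{TV}}(P,Q)=\frac12\sum_x|P(x)-Q(x)|$, $L_0=t\delta C_G$ and $L_{\mathrm{TV}}=L_0/2$. (1) For all $\theta,\theta'\in\Theta$, $\bigl|d_{\mathrm{TV}}(P_{\mathcal L(\theta)},Q)-d_{\mathrm{TV}}(P_{\mathcal L(\theta')},Q)\bigr|\le L_{\mathrm{TV}}\|\theta-\theta'\|_2$. (2) Suppose in addition that $\Theta$ has full measure, $\mu_S(S^{M-1}\setminus\Theta)=0$, and that $\mathbb E_{\theta\sim\mu_\Theta}d_{\mathrm{TV}}(P_{\mathcal L(\theta)},Q)\in[m_0-\epsilon_{\mathrm{mean}},m_0+\epsilon_{\mathrm{mean}}]$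 with $m_0>0$. Then for every $\xi>0$, $$\Pr_{\theta\sim\mu_\Theta}\bigl(|d_{\mathrm{TV}}(P_{\mathcal L(\theta)},Q)-m_0|\ge\xi+\epsilon_{\mathrm{mean}}\bigr)\le 2\exp\!\Bigl(-c_{\mathrm{par}}\frac{M\xi^2}{L_{\mathrm{TV}}^2}\Bigr).$$ (3) Under the assumptions of (2), if $\epsilon_{\mathrm{mean}}\le m_0/4$, then $\{\theta: d_{\mathrm{TV}}(P_{\mathcal L(\theta)},Q)\le m_0/2\}\subseteq\{\theta: |d_{\mathrm{TV}}(P_{\mathcal L(\theta)},Q)-m_0|\ge m_0/2\}$ and $$\Pr_{\theta\sim\mu_\Theta}\Bigl(d_{\mathrm{TV}}(P_{\mathcal L(\theta)},Q)\le\frac{m_0}{2}\Bigr)\le 2\exp\!\Bigl(-c_{\mathrm{par}}\frac{M\,m_0^2}{16L_{\mathrm{TV}}^2}\Bigr).$$ -/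

import Mathlib

/-!
The trace norm is a supremum over pairs of orthonormal bases, hence a norm, and reading out a POVM
after a positive trace-preserving map bounds the `ℓ¹`-norm of the outcome statistics by it.
Duhamel's formula `e^{tL'} - e^{tL} = ∫₀ᵗ e^{(t-s)L} (L' - L) e^{sL'} ds` therefore bounds the
change of the outcome distribution by `t` times the largest trace norm of `L' - L` on a state, and
Cauchy-Schwarz over the coordinates of `θ - θ'` cancels the factor `1 / √M`.

Lévy's inequality comes from Gaussian concentration. The Maurey-Pisier argument writes `f x - f y`
as an integral along the quarter turn from `y` to `x` in the plane of a Gaussian pair; at each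
angle the rotated pair is again Gaussian, so the exponential moments of `f x - f y` are at most
those of a Gaussian variable of standard deviation `π K / 2`. A `K`-Lipschitz function on the
sphere extends radially, and in polar coordinates the Gaussian norm is independent of the
direction. Its mean is at least `√(2 M / π)`, so averaging the radius out by Jensen's inequality
leaves the sphere with the exponential moments of a Gaussian of variance of order `K² / M`.
-/

open MeasureTheory
open scoped ENNReal CStarAlgebra

noncomputable section

namespace OpenSystem

section Quantum

/-- The algebra `B(H)` of operators on a finite-dimensional Hilbert space `H`, with its adjoint,
its operator norm and its Loewner order. -/
abbrev Op (H : Type*) [NormedAddCommGroup H] [InnerProductSpace ℂ H] := H →L[ℂ] H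

/-- Continuous linear endomorphisms of a normed space. -/
abbrev LinEnd (V : Type*) [NormedAddCommGroup V] [NormedSpace ℂ V] := V →L[ℂ] V

/-- Super-operators, i.e. linear maps `B(H) → B(H)` (all continuous when `H` is
finite-dimensional). -/
abbrev SuperOp (H : Type*) [NormedAddCommGroup H] [InnerProductSpace ℂ H] := LinEnd (Op H)

variable {H : Type*} [NormedAddCommGroup H] [InnerProductSpace ℂ H] [CompleteSpace H]

/-- The trace of an operator. -/
def tr (A : Op H) : ℂ := LinearMap.trace ℂ H A.toLinearMap

/-- The trace norm `‖A‖₁ = Tr √(A† A)`. -/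
def traceNorm (A : Op H) : ℝ := (tr (CFC.sqrt (star A * A))).re

/-- The induced norm `‖T‖_{1→1} = sup_{A ≠ 0} ‖T A‖₁ / ‖A‖₁`, as an extended non-negative
number. -/
def inducedOneNorm (T : SuperOp H) : ℝ≥0∞ :=
  ⨆ (A : Op H) (_ : A ≠ 0), ENNReal.ofReal (traceNorm (T A) / traceNorm A)

/-- `T` is completely positive and trace preserving. -/
def IsCPTP (T : SuperOp H) : Prop :=
  (∃ Φ : Op H →CP Op H, ∀ A, Φ A = T A) ∧ ∀ A, tr (T A) = tr A

/-- The evolution `Λ_t = e^{tL}`. -/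
def evolution (L : SuperOp H) (t : ℝ) : SuperOp H := NormedSpace.exp ((t : ℂ) • L)

/-- `L` is a GKSL generator (Lindbladian): it preserves Hermiticity, the flow it generates
preserves the trace (on the level of the generator: `Tr L(A) = 0`), and `e^{tL}` is completely
positive and trace preserving for every `t ≥ 0`. -/
structure IsGKSL (L : SuperOp H) : Prop where
  isSelfAdjoint_map : ∀ A : Op H, IsSelfAdjoint A → IsSelfAdjoint (L A)
  tr_map : ∀ A : Op H, tr (L A) = 0
  isCPTP_evolution : ∀ t : ℝ, 0 ≤ t → IsCPTP (evolution L t)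

/-- Density operators. -/
def IsState (ρ : Op H) : Prop := 0 ≤ ρ ∧ tr ρ = 1

/-- Positive operator valued measures with finite outcome set `X`. -/
def IsPOVM {X : Type*} [Fintype X] (E : X → Op H) : Prop :=
  (∀ x, 0 ≤ E x) ∧ ∑ x, E x = 1

/-- The output distribution `P_L(x) = Tr(E_x e^{tL}(ρ))`; for a GKSL generator, a state and a
POVM these traces are real. -/
def outputDist {X : Type*} (t : ℝ) (ρ : Op H) (E : X → Op H) (L : SuperOp H) (x : X) : ℝ :=
  (tr (E x * evolution L t ρ)).re

end Quantum

/-- Total variation distance on a finite set. -/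
def dTV {X : Type*} [Fintype X] (P Q : X → ℝ) : ℝ := (1 / 2) * ∑ x, |P x - Q x|

/-- The unit sphere `S^{M-1}` of `ℝ^M`, with the Euclidean distance. -/
abbrev ParamSphere (M : ℕ) : Type := Metric.sphere (0 : EuclideanSpace ℝ (Fin M)) 1

/-- The uniform probability measure on `S^{M-1}` (`M ≥ 1`): normalized surface measure. -/
def sphereMeasure (M : ℕ) : Measure (ParamSphere M) :=
  ((volume : Measure (EuclideanSpace ℝ (Fin M))).toSphere Set.univ)⁻¹ •
    (volume : Measure (EuclideanSpace ℝ (Fin M))).toSphere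

/-- The normalized restriction `μ_Θ` of the uniform measure to `Θ`. -/
def paramMeasure {M : ℕ} (Θ : Set (ParamSphere M)) : Measure (ParamSphere M) :=
  (sphereMeasure M Θ)⁻¹ • (sphereMeasure M).restrict Θ

/-- `c` is an admissible constant in Lévy's inequality (around the mean), for all spheres
`S^{M-1}`, all Lipschitz functions and all deviations. -/
def IsLevyConstant (c : ℝ) : Prop :=
  ∀ (M : ℕ), 1 ≤ M → ∀ (f : ParamSphere M → ℝ) (L τ : ℝ), 0 < L → 0 < τ →
    (∀ θ θ', |f θ - f θ'| ≤ L * dist θ θ') →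
    (sphereMeasure M).real {θ | τ ≤ |f θ - ∫ η, f η ∂sphereMeasure M|}
      ≤ 2 * Real.exp (-c * (M * τ ^ 2 / L ^ 2))

section Ensemble

variable {H : Type*} [NormedAddCommGroup H] [InnerProductSpace ℂ H] [CompleteSpace H] {M : ℕ}

/-- The parametrized generator `L(θ) = L_ref + (δ / √M) ∑ⱼ θⱼ Gⱼ`. -/
def generator (Lref : SuperOp H) (G : Fin M → SuperOp H) (δ : ℝ) (θ : ParamSphere M) :
    SuperOp H :=
  Lref + ((δ / √(M : ℝ) : ℝ) : ℂ) • ∑ j, (((θ : EuclideanSpace ℝ (Fin M)) j : ℝ) : ℂ) • G j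

/-- The function `θ ↦ d_TV(P_{L(θ)}, Q)`. -/
def tvToRef {X : Type*} [Fintype X] (Lref : SuperOp H) (G : Fin M → SuperOp H) (δ t : ℝ)
    (ρ : Op H) (E : X → Op H) (Q : X → ℝ) (θ : ParamSphere M) : ℝ :=
  dTV (outputDist t ρ E (generator Lref G δ θ)) Q

end Ensemble

end OpenSystem

end

noncomputable section

namespace OpenSystem

section GaussianConcentration

open ProbabilityTheory Real
open scoped NNReal Convolution

lemma ofReal_exp_integral_le_lintegral {α : Type*} [MeasurableSpace α] {μ : Measure α}
    [IsProbabilityMeasure μ] {f : α → ℝ} (hf : Integrable f μ) :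
    ENNReal.ofReal (exp (∫ x, f x ∂μ)) ≤ ∫⁻ x, ENNReal.ofReal (exp (f x)) ∂μ := by
  by_cases hexp : Integrable (fun x ↦ exp (f x)) μ
  · rw [← ofReal_integral_eq_lintegral_ofReal hexp (ae_of_all _ fun x ↦ (exp_pos _).le)]
    exact ENNReal.ofReal_le_ofReal <| convexOn_exp.map_integral_le continuous_exp.continuousOn
      isClosed_univ (ae_of_all _ fun _ ↦ Set.mem_univ _) hf hexp
  · have htop : ∫⁻ x, ENNReal.ofReal (exp (f x)) ∂μ = ⊤ := by
      by_contra hfin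
      refine hexp ⟨continuous_exp.comp_aestronglyMeasurable hf.1, ?_⟩
      exact (hasFiniteIntegral_iff_ofReal (ae_of_all _ fun x ↦ (exp_pos _).le)).2
        (lt_top_iff_ne_top.2 hfin)
    exact htop ▸ le_top

section Rotation

variable {V : Type*} [NormedAddCommGroup V] [NormedSpace ℝ V]

lemma continuous_rotation :
    Continuous fun z : ℝ × V × V ↦ ContinuousLinearMap.rotation z.1 z.2 := by
  simp only [ContinuousLinearMap.rotation_apply]
  fun_prop

lemma hasDerivAt_fst_rotation (p : V × V) (s : ℝ) :
    HasDerivAt (fun s ↦ (ContinuousLinearMap.rotation s p).1)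
      (ContinuousLinearMap.rotation s p).2 s := by
  simp only [ContinuousLinearMap.rotation_apply]
  exact ((hasDerivAt_cos s).smul_const p.1).add ((hasDerivAt_sin s).smul_const p.2)

/-- The derivative of `F` at the first component of `q`, in the direction of the second. Along the
path `s ↦ rotation s p` it is the velocity of `F`. -/
def pairDeriv (F : V → ℝ) (q : V × V) : ℝ := fderiv ℝ F q.1 q.2

lemma continuous_pairDeriv {F : V → ℝ} (hF : ContDiff ℝ 1 F) : Continuous (pairDeriv F) := by
  have := hF.continuous_fderiv one_ne_zero
  unfold pairDeriv
  fun_prop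

lemma continuous_pairDeriv_rotation {F : V → ℝ} (hF : ContDiff ℝ 1 F) (p : V × V) :
    Continuous fun s ↦ pairDeriv F (ContinuousLinearMap.rotation s p) := by
  have hrot : Continuous fun s : ℝ ↦ ContinuousLinearMap.rotation s p := by
    simp only [ContinuousLinearMap.rotation_apply]
    fun_prop
  exact (continuous_pairDeriv hF).comp hrot

lemma integral_pairDeriv_rotation {F : V → ℝ} (hF : ContDiff ℝ 1 F) (p : V × V) :
    ∫ s in 0..(π / 2), pairDeriv F (ContinuousLinearMap.rotation s p) = F p.2 - F p.1 := by
  have hderiv (s : ℝ) : HasDerivAt (fun s ↦ F (ContinuousLinearMap.rotation s p).1)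
      (pairDeriv F (ContinuousLinearMap.rotation s p)) s :=
    (hF.differentiable one_ne_zero _).hasFDerivAt.comp_hasDerivAt s (hasDerivAt_fst_rotation p s)
  rw [intervalIntegral.integral_eq_sub_of_hasDerivAt (fun s _ ↦ hderiv s)
    ((continuous_pairDeriv_rotation hF p).intervalIntegrable _ _)]
  simp [ContinuousLinearMap.rotation_apply]

/-- The uniform distribution of an angle in `(0, π / 2]`, along which the Maurey-Pisier path
`s ↦ rotation s p` is averaged. -/
def quarterTurn : Measure ℝ := volume[|Set.Ioc 0 (π / 2)]

instance : IsProbabilityMeasure quarterTurn :=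
  cond_isProbabilityMeasure_of_finite (by simp [pi_pos]) (by simp)

lemma ofReal_exp_sub_le_lintegral_quarterTurn {F : V → ℝ} (hF : ContDiff ℝ 1 F) (a : ℝ)
    (p : V × V) :
    ENNReal.ofReal (exp (a * (F p.2 - F p.1))) ≤ ∫⁻ s, ENNReal.ofReal
      (exp (a * (π / 2) * pairDeriv F (ContinuousLinearMap.rotation s p))) ∂quarterTurn := by
  have hcont := continuous_pairDeriv_rotation hF p
  have hint : Integrable (fun s ↦ pairDeriv F (ContinuousLinearMap.rotation s p)) quarterTurn :=
    hcont.integrableOn_Ioc.smul_measure (by simp [pi_pos])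
  have hmean : ∫ s, pairDeriv F (ContinuousLinearMap.rotation s p) ∂quarterTurn =
      (π / 2)⁻¹ * (F p.2 - F p.1) := by
    rw [quarterTurn, ProbabilityTheory.cond, integral_smul_measure,
      ← intervalIntegral.integral_of_le (by positivity), integral_pairDeriv_rotation hF,
      Real.volume_Ioc, sub_zero, ENNReal.toReal_inv,
      ENNReal.toReal_ofReal (by positivity), smul_eq_mul]
  refine le_of_eq_of_le ?_ (ofReal_exp_integral_le_lintegral (hint.const_mul (a * (π / 2))))
  rw [integral_const_mul, hmean]
  congr 2
  field_simp

end Rotation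

section Smoothing

variable {V : Type*} [NormedAddCommGroup V] [NormedSpace ℝ V] [FiniteDimensional ℝ V]
  {f : V → ℝ} {K : ℝ≥0}

lemma lipschitzWith_normed_convolution [MeasurableSpace V] [BorelSpace V] {μ : Measure V}
    [μ.IsAddHaarMeasure] (φ : ContDiffBump (0 : V)) (hf : LipschitzWith K f) :
    LipschitzWith K (φ.normed μ ⋆[ContinuousLinearMap.lsmul ℝ ℝ, μ] f) := by
  have hconv (x : V) :
      ConvolutionExistsAt (φ.normed μ) f x (ContinuousLinearMap.lsmul ℝ ℝ) μ :=
    φ.hasCompactSupport_normed.convolutionExists_left _ φ.continuous_normed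
      hf.continuous.locallyIntegrable x
  refine LipschitzWith.of_dist_le_mul fun x y ↦ ?_
  rw [dist_eq_norm, convolution, convolution, ← integral_sub (hconv x) (hconv y)]
  calc ‖∫ t, φ.normed μ t * f (x - t) - φ.normed μ t * f (y - t) ∂μ‖
      ≤ ∫ t, φ.normed μ t * (K * dist x y) ∂μ := by
        refine norm_integral_le_of_norm_le (φ.integrable_normed.mul_const _)
          (ae_of_all _ fun t ↦ ?_)
        rw [← mul_sub, norm_mul, Real.norm_of_nonneg (φ.nonneg_normed t), ← dist_eq_norm]
        refine mul_le_mul_of_nonneg_left ?_ (φ.nonneg_normed t)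
        simpa using hf.dist_le_mul (x - t) (y - t)
    _ = K * dist x y := by rw [integral_mul_const, φ.integral_normed, one_mul]

theorem exists_contDiff_lipschitzWith_dist_le (hf : LipschitzWith K f) {ε : ℝ} (hε : 0 < ε)
    (n : ℕ∞) : ∃ g : V → ℝ, ContDiff ℝ n g ∧ LipschitzWith K g ∧ ∀ x, dist (g x) (f x) ≤ ε := by
  borelize V
  obtain ⟨r, hr, hKr⟩ : ∃ r : ℝ, 0 < r ∧ K * r ≤ ε := by
    refine ⟨ε / (K + 1), by positivity, ?_⟩
    rw [mul_div_assoc', div_le_iff₀ (by positivity)]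
    nlinarith
  let μ : Measure V := Measure.addHaar
  let φ : ContDiffBump (0 : V) := ⟨r / 2, r, by positivity, by linarith⟩
  refine ⟨φ.normed μ ⋆[ContinuousLinearMap.lsmul ℝ ℝ, μ] f,
    φ.hasCompactSupport_normed.contDiff_convolution_left _ φ.contDiff_normed
      hf.continuous.locallyIntegrable,
    lipschitzWith_normed_convolution φ hf, fun x ↦ ?_⟩
  refine φ.dist_normed_convolution_le hf.continuous.aestronglyMeasurable fun y hy ↦ ?_
  calc dist (f y) (f x) ≤ K * dist y x := hf.dist_le_mul y x
    _ ≤ K * r := by gcongr; exact (Metric.mem_ball.1 hy).le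
    _ ≤ ε := hKr

end Smoothing

variable {E : Type*} [NormedAddCommGroup E] [InnerProductSpace ℝ E] [FiniteDimensional ℝ E]
  [MeasurableSpace E] [BorelSpace E]

lemma lintegral_exp_strongDual_stdGaussian (ℓ : StrongDual ℝ E) :
    ∫⁻ x, ENNReal.ofReal (exp (ℓ x)) ∂stdGaussian E = ENNReal.ofReal (exp (‖ℓ‖ ^ 2 / 2)) := by
  have hmap := IsGaussian.map_eq_gaussianReal (μ := stdGaussian E) ℓ
  rw [integral_strongDual_stdGaussian, variance_dual_stdGaussian] at hmap
  have hint : Integrable (fun x ↦ exp (ℓ x)) (stdGaussian E) := by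
    have : Integrable (fun x : ℝ ↦ exp (1 * x)) ((stdGaussian E).map ℓ) :=
      hmap ▸ integrable_exp_mul_gaussianReal 1
    simpa [Function.comp_def] using (integrable_map_measure (by fun_prop) (by fun_prop)).1 this
  have hmgf := mgf_gaussianReal hmap 1
  rw [← ofReal_integral_eq_lintegral_ofReal hint (ae_of_all _ fun x ↦ (exp_pos _).le)]
  simp only [mgf, one_mul] at hmgf
  simp [hmgf]

lemma map_rotation_prod_stdGaussian (s : ℝ) :
    ((stdGaussian E).prod (stdGaussian E)).map (ContinuousLinearMap.rotation s) =
      (stdGaussian E).prod (stdGaussian E) :=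
  have : CompleteSpace E := FiniteDimensional.complete ℝ E
  IsGaussian.map_rotation_eq_self_of_forall_strongDual_eq_zero
    (fun ℓ ↦ integral_strongDual_stdGaussian ℓ) s

lemma lintegral_exp_pairDeriv_stdGaussian_le {F : E → ℝ} (hF : ContDiff ℝ 1 F) {K : ℝ≥0}
    (hK : LipschitzWith K F) (b : ℝ) :
    ∫⁻ q, ENNReal.ofReal (exp (b * pairDeriv F q)) ∂(stdGaussian E).prod (stdGaussian E) ≤
      ENNReal.ofReal (exp (b ^ 2 * K ^ 2 / 2)) := by
  have hcont := continuous_pairDeriv hF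
  rw [lintegral_prod _ (by fun_prop)]
  calc ∫⁻ x, ∫⁻ y, ENNReal.ofReal (exp ((b • fderiv ℝ F x) y)) ∂stdGaussian E ∂stdGaussian E
      ≤ ∫⁻ _, ENNReal.ofReal (exp (b ^ 2 * K ^ 2 / 2)) ∂stdGaussian E := by
        refine lintegral_mono fun x ↦ ?_
        rw [lintegral_exp_strongDual_stdGaussian, norm_smul, mul_pow, Real.norm_eq_abs, sq_abs]
        gcongr
        exact norm_fderiv_le_of_lipschitz ℝ hK
    _ = ENNReal.ofReal (exp (b ^ 2 * K ^ 2 / 2)) := by simp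

lemma lintegral_exp_sub_stdGaussian_le_of_contDiff {F : E → ℝ} (hF : ContDiff ℝ 1 F) {K : ℝ≥0}
    (hK : LipschitzWith K F) (a : ℝ) :
    ∫⁻ p, ENNReal.ofReal (exp (a * (F p.2 - F p.1))) ∂(stdGaussian E).prod (stdGaussian E) ≤
      ENNReal.ofReal (exp (a ^ 2 * π ^ 2 * K ^ 2 / 8)) := by
  set γ₂ := (stdGaussian E).prod (stdGaussian E)
  let speed : E × E → ℝ≥0∞ := fun q ↦ ENNReal.ofReal (exp (a * (π / 2) * pairDeriv F q))
  have hspeed : Measurable speed := by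
    have := continuous_pairDeriv hF
    fun_prop
  calc ∫⁻ p, ENNReal.ofReal (exp (a * (F p.2 - F p.1))) ∂γ₂
      ≤ ∫⁻ p, ∫⁻ s, speed (ContinuousLinearMap.rotation s p) ∂quarterTurn ∂γ₂ :=
        lintegral_mono (ofReal_exp_sub_le_lintegral_quarterTurn hF a)
    _ = ∫⁻ s, ∫⁻ p, speed (ContinuousLinearMap.rotation s p) ∂γ₂ ∂quarterTurn :=
        lintegral_lintegral_swap
          (hspeed.comp (continuous_rotation.comp continuous_swap).measurable).aemeasurable
    _ = ∫⁻ _, ∫⁻ q, speed q ∂γ₂ ∂quarterTurn := by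
        refine lintegral_congr fun s ↦ ?_
        rw [← lintegral_map hspeed (ContinuousLinearMap.measurable _),
          map_rotation_prod_stdGaussian]
    _ = ∫⁻ q, speed q ∂γ₂ := by simp
    _ ≤ ENNReal.ofReal (exp ((a * (π / 2)) ^ 2 * K ^ 2 / 2)) :=
        lintegral_exp_pairDeriv_stdGaussian_le hF hK _
    _ = ENNReal.ofReal (exp (a ^ 2 * π ^ 2 * K ^ 2 / 8)) := by ring_nf

theorem lintegral_exp_sub_stdGaussian_le {F : E → ℝ} {K : ℝ≥0} (hF : LipschitzWith K F) (a : ℝ) :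
    ∫⁻ p, ENNReal.ofReal (exp (a * (F p.2 - F p.1))) ∂(stdGaussian E).prod (stdGaussian E) ≤
      ENNReal.ofReal (exp (a ^ 2 * π ^ 2 * K ^ 2 / 8)) := by
  set B : ℝ := exp (a ^ 2 * π ^ 2 * K ^ 2 / 8)
  have hsmooth (ε : ℝ) (hε : 0 < ε) :
      ∫⁻ p, ENNReal.ofReal (exp (a * (F p.2 - F p.1))) ∂(stdGaussian E).prod (stdGaussian E) ≤
        ENNReal.ofReal (exp (2 * |a| * ε) * B) := by
    obtain ⟨G, hG, hGK, hGF⟩ := exists_contDiff_lipschitzWith_dist_le hF hε 1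
    have hexponent (p : E × E) : a * (F p.2 - F p.1) ≤ 2 * |a| * ε + a * (G p.2 - G p.1) := by
      have h₁ := abs_le.1 (hGF p.1)
      have h₂ := abs_le.1 (hGF p.2)
      have h : |(F p.2 - F p.1) - (G p.2 - G p.1)| ≤ 2 * ε := by
        rw [abs_le]; constructor <;> linarith
      have := (le_abs_self _).trans ((abs_mul a _).trans_le (mul_le_mul_of_nonneg_left h
        (abs_nonneg a)))
      linarith
    calc ∫⁻ p, ENNReal.ofReal (exp (a * (F p.2 - F p.1))) ∂(stdGaussian E).prod (stdGaussian E)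
        ≤ ∫⁻ p, ENNReal.ofReal (exp (2 * |a| * ε)) * ENNReal.ofReal (exp (a * (G p.2 - G p.1)))
            ∂(stdGaussian E).prod (stdGaussian E) := by
          refine lintegral_mono fun p ↦ ?_
          rw [← ENNReal.ofReal_mul (exp_pos _).le, ← exp_add]
          gcongr
          exact hexponent p
      _ ≤ ENNReal.ofReal (exp (2 * |a| * ε) * B) := by
          rw [lintegral_const_mul' _ _ ENNReal.ofReal_ne_top, ENNReal.ofReal_mul (exp_pos _).le]
          gcongr
          exact lintegral_exp_sub_stdGaussian_le_of_contDiff hG hGK a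
  have hcont : Continuous fun ε : ℝ ↦ ENNReal.ofReal (exp (2 * |a| * ε) * B) :=
    ENNReal.continuous_ofReal.comp (by fun_prop)
  have hlim := (hcont.tendsto 0).mono_left (nhdsWithin_le_nhds (s := Set.Ioi 0))
  simp only [mul_zero, exp_zero, one_mul] at hlim
  exact ge_of_tendsto hlim (Filter.eventually_of_mem self_mem_nhdsWithin hsmooth)

lemma integrable_norm_stdGaussian : Integrable (fun x : E ↦ ‖x‖) (stdGaussian E) :=
  have : CompleteSpace E := FiniteDimensional.complete ℝ E
  (IsGaussian.integrable_id (μ := stdGaussian E)).norm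

lemma integrable_stdGaussian_of_lipschitzWith {F : E → ℝ} {K : ℝ≥0} (hF : LipschitzWith K F) :
    Integrable F (stdGaussian E) := by
  refine ((integrable_norm_stdGaussian.const_mul (K : ℝ)).add
    (integrable_const ‖F 0‖)).mono' hF.continuous.aestronglyMeasurable (ae_of_all _ fun x ↦ ?_)
  have := hF.dist_le_mul x 0
  rw [dist_eq_norm, dist_zero_right] at this
  change ‖F x‖ ≤ K * ‖x‖ + ‖F 0‖
  linarith [norm_le_norm_sub_add (F x) (F 0)]

theorem lintegral_exp_mul_stdGaussian_le {F : E → ℝ} {K : ℝ≥0} (hF : LipschitzWith K F)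
    (hmean : ∫ x, F x ∂stdGaussian E = 0) (a : ℝ) :
    ∫⁻ x, ENNReal.ofReal (exp (a * F x)) ∂stdGaussian E ≤
      ENNReal.ofReal (exp (a ^ 2 * π ^ 2 * K ^ 2 / 8)) := by
  have hFi := integrable_stdGaussian_of_lipschitzWith hF
  have hFm := hF.continuous.measurable
  -- An independent copy of the argument contributes the mean `0`, so Jensen inserts it for free.
  calc ∫⁻ x, ENNReal.ofReal (exp (a * F x)) ∂stdGaussian E
      ≤ ∫⁻ x, ∫⁻ y, ENNReal.ofReal (exp (-a * (F y - F x))) ∂stdGaussian E ∂stdGaussian E := by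
        refine lintegral_mono fun x ↦ ?_
        have hdiff : Integrable (fun y ↦ F y - F x) (stdGaussian E) :=
          hFi.sub (integrable_const _)
        refine le_of_eq_of_le ?_ (ofReal_exp_integral_le_lintegral (hdiff.const_mul (-a)))
        rw [integral_const_mul, integral_sub hFi (integrable_const _), hmean]
        simp
    _ = ∫⁻ p, ENNReal.ofReal (exp (-a * (F p.2 - F p.1)))
          ∂(stdGaussian E).prod (stdGaussian E) := by
        symm
        exact lintegral_prod (fun p : E × E ↦ ENNReal.ofReal (exp (-a * (F p.2 - F p.1))))
          (by fun_prop)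
    _ ≤ ENNReal.ofReal (exp (a ^ 2 * π ^ 2 * K ^ 2 / 8)) := by
        simpa only [neg_sq] using lintegral_exp_sub_stdGaussian_le hF (-a)

end GaussianConcentration

section PolarCoordinates

variable {V : Type*} [NormedAddCommGroup V] [NormedSpace ℝ V]

lemma norm_smul_sphere (θ : Metric.sphere (0 : V) 1) {r : ℝ} (hr : 0 ≤ r) : ‖r • (θ : V)‖ = r := by
  rw [norm_smul, norm_eq_of_mem_sphere, mul_one, Real.norm_of_nonneg hr]

variable [MeasurableSpace V]

/-- The uniform probability measure on the unit sphere of a normed space: the normalized surface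
measure attached to the Haar measure `μ`. -/
def uniformSphere (μ : Measure V) : Measure (Metric.sphere (0 : V) 1) :=
  (μ.toSphere Set.univ)⁻¹ • μ.toSphere

variable [FiniteDimensional ℝ V] [Nontrivial V] [BorelSpace V] (μ : Measure V) [μ.IsAddHaarMeasure]

lemma toSphere_univ_ne_zero : μ.toSphere Set.univ ≠ 0 := by
  rw [Ne, Measure.measure_univ_eq_zero]
  exact Measure.toSphere_ne_zero μ

instance : IsProbabilityMeasure (uniformSphere μ) :=
  ⟨ENNReal.inv_mul_cancel (toSphere_univ_ne_zero μ) (measure_ne_top _ _)⟩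

lemma lintegral_eq_lintegral_toSphere {f : V → ℝ≥0∞} (hf : Measurable f) :
    ∫⁻ x, f x ∂μ = ∫⁻ θ, ∫⁻ r, f ((r : ℝ) • (θ : V))
      ∂Measure.volumeIoiPow (Module.finrank ℝ V - 1) ∂μ.toSphere := by
  have hpolar : Measurable fun p : Metric.sphere (0 : V) 1 × Set.Ioi (0 : ℝ) ↦
      f ((p.2 : ℝ) • (p.1 : V)) := hf.comp (by fun_prop)
  rw [← lintegral_prod _ hpolar.aemeasurable,
    ← μ.measurePreserving_homeomorphUnitSphereProd.lintegral_comp hpolar]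
  calc ∫⁻ x, f x ∂μ = ∫⁻ x in ({0}ᶜ : Set V), f x ∂μ := by rw [restrict_compl_singleton]
    _ = ∫⁻ x : ({0}ᶜ : Set V), f x ∂μ.comap Subtype.val :=
      (lintegral_subtype_comap (measurableSet_singleton _).compl f).symm
    _ = _ := by
      refine lintegral_congr fun x ↦ ?_
      have hx : ‖(x : V)‖ ≠ 0 := norm_ne_zero_iff.2 x.2
      simp [smul_smul, hx]

theorem lintegral_lintegral_norm_smul {f : V → ℝ≥0∞} (hf : Measurable f) :
    ∫⁻ θ, ∫⁻ x, f (‖x‖ • (θ : V)) ∂μ ∂uniformSphere μ = ∫⁻ x, f x ∂μ := by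
  have hinner (θ : Metric.sphere (0 : V) 1) : ∫⁻ x, f (‖x‖ • (θ : V)) ∂μ = μ.toSphere Set.univ *
      ∫⁻ r, f ((r : ℝ) • (θ : V)) ∂Measure.volumeIoiPow (Module.finrank ℝ V - 1) := by
    have hnorm (η : Metric.sphere (0 : V) 1) (r : Set.Ioi (0 : ℝ)) :
        ‖(r : ℝ) • (η : V)‖ = (r : ℝ) := norm_smul_sphere η (le_of_lt r.2)
    rw [lintegral_eq_lintegral_toSphere μ (by fun_prop)]
    simp only [hnorm, lintegral_const, mul_comm]
  rw [lintegral_congr hinner, uniformSphere, lintegral_smul_measure, smul_eq_mul,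
    lintegral_const_mul' _ _ (measure_ne_top _ _), ← mul_assoc,
    ENNReal.inv_mul_cancel (toSphere_univ_ne_zero μ) (measure_ne_top _ _), one_mul,
    lintegral_eq_lintegral_toSphere μ hf]

theorem map_norm_smul_prod_withDensity {d : ℝ → ℝ≥0∞} (hd : Measurable d)
    [SFinite (μ.withDensity fun x ↦ d ‖x‖)] :
    ((uniformSphere μ).prod (μ.withDensity fun x ↦ d ‖x‖)).map (fun p ↦ ‖p.2‖ • (p.1 : V)) =
      μ.withDensity fun x ↦ d ‖x‖ := by
  have hpolar : Measurable fun p : Metric.sphere (0 : V) 1 × V ↦ ‖p.2‖ • (p.1 : V) := by fun_prop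
  have hd' : Measurable fun x : V ↦ d ‖x‖ := by fun_prop
  refine Measure.ext_of_lintegral _ fun f hf ↦ ?_
  rw [lintegral_map hf hpolar, lintegral_withDensity_eq_lintegral_mul _ hd' hf,
    ← lintegral_lintegral_norm_smul μ (hd'.mul hf), lintegral_prod
      (fun p : Metric.sphere (0 : V) 1 × V ↦ f (‖p.2‖ • (p.1 : V))) (hf.comp hpolar).aemeasurable]
  refine lintegral_congr fun θ ↦ ?_
  rw [lintegral_withDensity_eq_lintegral_mul μ hd'
    (show Measurable fun x : V ↦ f (‖x‖ • (θ : V)) from hf.comp (by fun_prop))]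
  simp only [Pi.mul_apply, norm_smul, norm_norm, norm_eq_of_mem_sphere, mul_one]

end PolarCoordinates

section GaussianNorm

open ProbabilityTheory Real

lemma sum_abs_inner_le_sqrt_card_mul_norm {F ι : Type*} [NormedAddCommGroup F]
    [InnerProductSpace ℝ F] [Fintype ι] (b : OrthonormalBasis ι ℝ F) (x : F) :
    ∑ i, |inner ℝ (b i) x| ≤ √(Fintype.card ι) * ‖x‖ := by
  refine abs_le_of_sq_le_sq' ?_ (by positivity) |>.2
  rw [mul_pow, sq_sqrt (by positivity), ← b.sum_sq_norm_inner_right x]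
  exact sq_sum_le_card_mul_sum_sq

variable {E : Type*} [NormedAddCommGroup E] [InnerProductSpace ℝ E] [FiniteDimensional ℝ E]
  [MeasurableSpace E] [BorelSpace E]

lemma integral_exp_neg_half_mul_norm_sq :
    ∫ x : E, exp (-(1 / 2) * ‖x‖ ^ 2) = (2 * π) ^ (Module.finrank ℝ E / 2 : ℝ) := by
  rw [GaussianFourier.integral_rexp_neg_mul_sq_norm (by norm_num : (0 : ℝ) < 1 / 2)]
  congr 1
  ring

lemma integral_cexp_neg_half_mul_norm_sq_add_inner (t : E) :
    ∫ x : E, Complex.exp (-(1 / 2) * ‖x‖ ^ 2 + Complex.I * inner ℝ t x) =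
      ((2 * π) ^ (Module.finrank ℝ E / 2 : ℝ) : ℝ) * Complex.exp (-‖t‖ ^ 2 / 2) := by
  rw [GaussianFourier.integral_cexp_neg_mul_sq_norm_add (by norm_num),
    Complex.ofReal_cpow (by positivity), Complex.I_sq]
  push_cast
  congr 2 <;> ring

theorem stdGaussian_eq_withDensity :
    stdGaussian E = (volume : Measure E).withDensity fun x ↦
      ENNReal.ofReal (((2 * π) ^ (Module.finrank ℝ E / 2 : ℝ))⁻¹ * exp (-(1 / 2) * ‖x‖ ^ 2)) := by
  set c : ℝ := (2 * π) ^ (Module.finrank ℝ E / 2 : ℝ) with hc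
  have hc0 : 0 < c := by positivity
  have hint : Integrable fun x : E ↦ exp (-(1 / 2) * ‖x‖ ^ 2) :=
    .of_integral_ne_zero (integral_exp_neg_half_mul_norm_sq.trans_ne hc0.ne')
  have hfin : IsFiniteMeasure ((volume : Measure E).withDensity fun x ↦
      ENNReal.ofReal (c⁻¹ * exp (-(1 / 2) * ‖x‖ ^ 2))) :=
    isFiniteMeasure_withDensity_ofReal (hint.const_mul c⁻¹).2
  have : CompleteSpace E := FiniteDimensional.complete ℝ E
  refine Measure.ext_of_charFun (funext fun t ↦ ?_)
  have hdensity (x : E) : (ENNReal.ofReal (c⁻¹ * exp (-(1 / 2) * ‖x‖ ^ 2))).toReal •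
      Complex.exp (inner ℝ x t * Complex.I) =
      (c⁻¹ : ℂ) * Complex.exp (-(1 / 2) * ‖x‖ ^ 2 + Complex.I * inner ℝ t x) := by
    rw [ENNReal.toReal_ofReal (by positivity), Complex.real_smul, Complex.exp_add,
      real_inner_comm t x]
    push_cast
    ring_nf
  rw [charFun_stdGaussian, charFun_apply,
    integral_withDensity_eq_integral_toReal_smul (by fun_prop) (by simp)]
  simp_rw [hdensity]
  rw [integral_const_mul, integral_cexp_neg_half_mul_norm_sq_add_inner, ← hc, ← mul_assoc,
    inv_mul_cancel₀ (Complex.ofReal_ne_zero.2 hc0.ne'), one_mul]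

theorem map_norm_smul_prod_stdGaussian [Nontrivial E] :
    ((uniformSphere (volume : Measure E)).prod (stdGaussian E)).map
      (fun p ↦ ‖p.2‖ • (p.1 : E)) = stdGaussian E := by
  rw [stdGaussian_eq_withDensity]
  exact map_norm_smul_prod_withDensity volume (d := fun r ↦
    ENNReal.ofReal (((2 * π) ^ (Module.finrank ℝ E / 2 : ℝ))⁻¹ * exp (-(1 / 2) * r ^ 2)))
    (by fun_prop)

lemma integral_abs_gaussianReal : ∫ x, |x| ∂gaussianReal 0 1 = √(2 / π) := by
  have hgamma : ∫ x in Set.Ioi (0 : ℝ), x * exp (-(1 / 2) * x ^ 2) = 1 := by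
    have h := integral_rpow_mul_exp_neg_mul_rpow (p := 2) (q := 1) (b := 1 / 2)
      (by norm_num) (by norm_num) (by norm_num)
    norm_num at h ⊢
    exact h
  calc ∫ x, |x| ∂gaussianReal 0 1
      = ∫ x : ℝ, (√(2 * π))⁻¹ * (|x| * exp (-(1 / 2) * |x| ^ 2)) := by
        rw [integral_gaussianReal_eq_integral_smul one_ne_zero]
        refine integral_congr_ae (ae_of_all _ fun x ↦ ?_)
        simp only [gaussianPDFReal, NNReal.coe_one, mul_one, sub_zero, smul_eq_mul, sq_abs]
        ring_nf
    _ = (√(2 * π))⁻¹ * 2 := by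
        rw [integral_const_mul, integral_comp_abs (f := fun r ↦ r * exp (-(1 / 2) * r ^ 2)),
          hgamma, mul_one]
    _ = √(2 / π) := by
        rw [sqrt_div' _ pi_pos.le, sqrt_mul zero_le_two]
        field_simp
        norm_num

lemma integral_abs_strongDual_stdGaussian {ℓ : StrongDual ℝ E} (hℓ : ‖ℓ‖ = 1) :
    ∫ x, |ℓ x| ∂stdGaussian E = √(2 / π) := by
  have hmap := IsGaussian.map_eq_gaussianReal (μ := stdGaussian E) ℓ
  rw [integral_strongDual_stdGaussian, variance_dual_stdGaussian, hℓ, one_pow, toNNReal_one]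
    at hmap
  rw [← integral_abs_gaussianReal, ← hmap, integral_map (by fun_prop) (by fun_prop)]

theorem sqrt_le_integral_norm_stdGaussian :
    √(Module.finrank ℝ E * (2 / π)) ≤ ∫ x, ‖x‖ ∂stdGaussian E := by
  set n := Module.finrank ℝ E
  let b := stdOrthonormalBasis ℝ E
  have hsum : n * √(2 / π) ≤ √n * ∫ x, ‖x‖ ∂stdGaussian E := by
    have hcoord (i : Fin n) : Integrable (fun x ↦ |innerSL ℝ (b i) x|) (stdGaussian E) :=
      (integrable_stdGaussian_of_lipschitzWith (innerSL ℝ (b i)).lipschitz).abs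
    calc n * √(2 / π) = ∑ i, ∫ x, |innerSL ℝ (b i) x| ∂stdGaussian E := by
          have (i : Fin n) : ∫ x, |innerSL ℝ (b i) x| ∂stdGaussian E = √(2 / π) :=
            integral_abs_strongDual_stdGaussian (by simp)
          simp only [this, Finset.sum_const, Finset.card_univ, Fintype.card_fin, nsmul_eq_mul, n]
      _ = ∫ x, ∑ i, |innerSL ℝ (b i) x| ∂stdGaussian E :=
          (integral_finsetSum _ fun i _ ↦ hcoord i).symm
      _ ≤ ∫ x, √n * ‖x‖ ∂stdGaussian E := by
          refine integral_mono (integrable_finsetSum _ fun i _ ↦ hcoord i)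
            (integrable_norm_stdGaussian.const_mul _) fun x ↦ ?_
          simpa [n] using sum_abs_inner_le_sqrt_card_mul_norm b x
      _ = √n * ∫ x, ‖x‖ ∂stdGaussian E := integral_const_mul _ _
  rcases n.eq_zero_or_pos with hn | hn
  · simpa [hn] using integral_nonneg fun x : E ↦ norm_nonneg x
  · refine le_of_mul_le_mul_left ?_ (by positivity : 0 < √(n : ℝ))
    rwa [sqrt_mul n.cast_nonneg, ← mul_assoc, mul_self_sqrt n.cast_nonneg]

end GaussianNorm

section RadialExtension

variable {V : Type*} [NormedAddCommGroup V] [NormedSpace ℝ V]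

/-- The extension of a function on the unit sphere to a positively homogeneous function of degree
one on the whole space. -/
def radialExtension (f : Metric.sphere (0 : V) 1 → ℝ) (x : V) : ℝ :=
  ‖x‖ * Function.extend Subtype.val f 0 (‖x‖⁻¹ • x)

lemma radialExtension_smul (f : Metric.sphere (0 : V) 1 → ℝ) (θ : Metric.sphere (0 : V) 1)
    {r : ℝ} (hr : 0 ≤ r) : radialExtension f (r • (θ : V)) = r * f θ := by
  rw [radialExtension, norm_smul_sphere θ hr]
  rcases hr.eq_or_lt with rfl | hr
  · simp
  · rw [smul_smul, inv_mul_cancel₀ hr.ne', one_smul, Subtype.val_injective.extend_apply]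

lemma exists_norm_smul_sphere_eq [Nontrivial V] (x : V) :
    ∃ θ : Metric.sphere (0 : V) 1, ‖x‖ • (θ : V) = x := by
  rcases eq_or_ne x 0 with rfl | hx
  · obtain ⟨θ, hθ⟩ := NormedSpace.sphere_nonempty (x := (0 : V)).2 zero_le_one
    exact ⟨⟨θ, hθ⟩, by simp⟩
  · have hx' := norm_ne_zero_iff.2 hx
    exact ⟨⟨‖x‖⁻¹ • x, by simp [norm_smul, hx']⟩, by simp [smul_smul, hx']⟩

lemma mul_dist_sphere_le (θ η : Metric.sphere (0 : V) 1) {r s : ℝ} (hr : 0 ≤ r) (hs : 0 ≤ s) :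
    r * dist θ η ≤ 2 * ‖r • (θ : V) - s • (η : V)‖ := by
  have hrs : |r - s| ≤ ‖r • (θ : V) - s • (η : V)‖ := by
    simpa only [norm_smul_sphere, hr, hs] using abs_norm_sub_norm_le (r • (θ : V)) (s • (η : V))
  calc r * dist θ η = ‖(r • (θ : V) - s • (η : V)) - (r - s) • (η : V)‖ := by
        rw [sub_smul, sub_sub_sub_cancel_right, ← smul_sub, norm_smul, Real.norm_of_nonneg hr,
          Subtype.dist_eq, dist_eq_norm]
    _ ≤ ‖r • (θ : V) - s • (η : V)‖ + |r - s| := by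
        refine (norm_sub_le _ _).trans_eq ?_
        rw [norm_smul (r - s), norm_eq_of_mem_sphere, mul_one, Real.norm_eq_abs]
    _ ≤ 2 * ‖r • (θ : V) - s • (η : V)‖ := by linarith

theorem lipschitzWith_radialExtension [Nontrivial V] {f : Metric.sphere (0 : V) 1 → ℝ}
    {K B : NNReal} (hf : LipschitzWith K f) (hB : ∀ θ, |f θ| ≤ B) :
    LipschitzWith (2 * K + B) (radialExtension f) := by
  refine LipschitzWith.of_dist_le_mul fun x y ↦ ?_
  obtain ⟨θ, hθ⟩ := exists_norm_smul_sphere_eq x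
  obtain ⟨η, hη⟩ := exists_norm_smul_sphere_eq y
  have hdist := mul_dist_sphere_le θ η (norm_nonneg x) (norm_nonneg y)
  have hFx := radialExtension_smul f θ (norm_nonneg x)
  have hFy := radialExtension_smul f η (norm_nonneg y)
  rw [hθ] at hFx
  rw [hη] at hFy
  rw [hθ, hη] at hdist
  rw [Real.dist_eq, dist_eq_norm, hFx, hFy]
  push_cast
  calc |‖x‖ * f θ - ‖y‖ * f η| = |‖x‖ * (f θ - f η) + (‖x‖ - ‖y‖) * f η| := by ring_nf
    _ ≤ ‖x‖ * |f θ - f η| + |‖x‖ - ‖y‖| * |f η| := by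
        refine (abs_add_le _ _).trans_eq ?_
        rw [abs_mul, abs_mul, abs_norm]
    _ ≤ ‖x‖ * (K * dist θ η) + ‖x - y‖ * B := by
        gcongr
        · exact hf.dist_le_mul θ η
        · exact abs_norm_sub_norm_le x y
        · exact hB η
    _ = K * (‖x‖ * dist θ η) + ‖x - y‖ * B := by ring
    _ ≤ K * (2 * ‖x - y‖) + ‖x - y‖ * B := by gcongr
    _ = (2 * K + B) * ‖x - y‖ := by ring

lemma measurable_radialExtension [MeasurableSpace V] [BorelSpace V]
    {f : Metric.sphere (0 : V) 1 → ℝ} (hf : Measurable f) : Measurable (radialExtension f) := by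
  have hextend : Measurable (Function.extend Subtype.val f (0 : V → ℝ)) :=
    (MeasurableEmbedding.subtype_coe Metric.isClosed_sphere.measurableSet).measurable_extend hf
      measurable_zero
  exact measurable_norm.mul (hextend.comp (measurable_norm.inv.smul measurable_id))

end RadialExtension

lemma abs_sub_integral_le_of_lipschitzWith {α : Type*} [PseudoMetricSpace α] [MeasurableSpace α]
    {μ : Measure α} [IsProbabilityMeasure μ] {f : α → ℝ} {K : NNReal} (hf : LipschitzWith K f)
    (hfi : Integrable f μ) {D : ℝ} (hD : ∀ x y : α, dist x y ≤ D) (x : α) :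
    |f x - ∫ y, f y ∂μ| ≤ K * D := by
  have hmean : f x - ∫ y, f y ∂μ = ∫ y, (f x - f y) ∂μ := by
    rw [integral_sub (integrable_const _) hfi]
    simp
  rw [hmean, ← Real.norm_eq_abs]
  have hbound (y : α) : ‖f x - f y‖ ≤ K * D :=
    (hf.dist_le_mul x y).trans (mul_le_mul_of_nonneg_left (hD x y) K.coe_nonneg)
  simpa using norm_integral_le_of_norm_le_const (μ := μ) (ae_of_all _ hbound)

section SphereConcentration

open ProbabilityTheory Real
open scoped NNReal

variable {E : Type*} [NormedAddCommGroup E] [InnerProductSpace ℝ E] [FiniteDimensional ℝ E]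
  [MeasurableSpace E] [BorelSpace E] [Nontrivial E] {f : Metric.sphere (0 : E) 1 → ℝ} {K : ℝ≥0}

lemma integral_radialExtension_stdGaussian (hf : Measurable f) :
    ∫ x, radialExtension f x ∂stdGaussian E =
      (∫ x, ‖x‖ ∂stdGaussian E) * ∫ θ, f θ ∂uniformSphere (volume : Measure E) := by
  have hpolar : Measurable fun p : Metric.sphere (0 : E) 1 × E ↦ ‖p.2‖ • (p.1 : E) := by fun_prop
  conv_lhs => rw [← map_norm_smul_prod_stdGaussian (E := E)]
  rw [integral_map hpolar.aemeasurable (measurable_radialExtension hf).aestronglyMeasurable,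
    mul_comm, ← integral_prod_mul f (fun x : E ↦ ‖x‖)]
  simp only [radialExtension_smul f _ (norm_nonneg _), mul_comm]

lemma integrable_uniformSphere_of_continuous {g : Metric.sphere (0 : E) 1 → ℝ}
    (hg : Continuous g) : Integrable g (uniformSphere (volume : Measure E)) :=
  hg.integrable_of_hasCompactSupport (.of_compactSpace g)

lemma lintegral_exp_uniformSphere_le_of_radialExtension (hf : Measurable f)
    (hK : LipschitzWith K (radialExtension f))
    (hmean : ∫ θ, f θ ∂uniformSphere (volume : Measure E) = 0) (a : ℝ) :
    ∫⁻ θ, ENNReal.ofReal (exp (a * ((∫ x, ‖x‖ ∂stdGaussian E) * f θ)))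
      ∂uniformSphere (volume : Measure E) ≤ ENNReal.ofReal (exp (a ^ 2 * π ^ 2 * K ^ 2 / 8)) := by
  have hpolar : Measurable fun p : Metric.sphere (0 : E) 1 × E ↦ ‖p.2‖ • (p.1 : E) := by fun_prop
  let expF : E → ℝ≥0∞ := fun x ↦ ENNReal.ofReal (exp (a * radialExtension f x))
  have hexpF : Measurable expF := by
    have := measurable_radialExtension hf
    fun_prop
  calc ∫⁻ θ, ENNReal.ofReal (exp (a * ((∫ x, ‖x‖ ∂stdGaussian E) * f θ)))
        ∂uniformSphere (volume : Measure E)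
      ≤ ∫⁻ θ, ∫⁻ x, expF (‖x‖ • (θ : E)) ∂stdGaussian E ∂uniformSphere (volume : Measure E) := by
        refine lintegral_mono fun θ ↦ ?_
        have hjensen := ofReal_exp_integral_le_lintegral
          ((integrable_norm_stdGaussian (E := E)).mul_const (f θ) |>.const_mul a)
        rw [integral_const_mul, integral_mul_const] at hjensen
        simpa only [expF, radialExtension_smul f _ (norm_nonneg _)] using hjensen
    _ = ∫⁻ x, expF x ∂stdGaussian E := by
        conv_rhs => rw [← map_norm_smul_prod_stdGaussian (E := E)]
        rw [lintegral_map hexpF hpolar]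
        symm
        exact lintegral_prod (fun p : Metric.sphere (0 : E) 1 × E ↦ expF (‖p.2‖ • (p.1 : E)))
          (hexpF.comp hpolar).aemeasurable
    _ ≤ ENNReal.ofReal (exp (a ^ 2 * π ^ 2 * K ^ 2 / 8)) := by
        refine lintegral_exp_mul_stdGaussian_le hK ?_ a
        rw [integral_radialExtension_stdGaussian hf, hmean, mul_zero]

lemma lintegral_exp_uniformSphere_le (hf : LipschitzWith K f)
    (hmean : ∫ θ, f θ ∂uniformSphere (volume : Measure E) = 0) (a : ℝ) :
    ∫⁻ θ, ENNReal.ofReal (exp (a * ((∫ x, ‖x‖ ∂stdGaussian E) * f θ)))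
      ∂uniformSphere (volume : Measure E) ≤ ENNReal.ofReal (exp (2 * a ^ 2 * π ^ 2 * K ^ 2)) := by
  have hdist (θ η : Metric.sphere (0 : E) 1) : dist θ η ≤ 2 := by
    refine (dist_triangle_right (θ : E) η 0).trans_eq ?_
    rw [θ.2, η.2, one_add_one_eq_two]
  have hbound (θ : Metric.sphere (0 : E) 1) : |f θ| ≤ (2 * K : ℝ≥0) := by
    have := abs_sub_integral_le_of_lipschitzWith hf
      (integrable_uniformSphere_of_continuous hf.continuous) hdist θ
    rw [hmean, sub_zero] at this
    push_cast
    linarith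
  refine (lintegral_exp_uniformSphere_le_of_radialExtension hf.continuous.measurable
    (lipschitzWith_radialExtension hf hbound) hmean a).trans_eq ?_
  push_cast
  ring_nf

theorem hasSubgaussianMGF_uniformSphere (hf : LipschitzWith K f)
    (hmean : ∫ θ, f θ ∂uniformSphere (volume : Measure E) = 0) :
    HasSubgaussianMGF f (2 * π ^ 3 * K ^ 2 / Module.finrank ℝ E).toNNReal
      (uniformSphere (volume : Measure E)) := by
  have hint (t : ℝ) : Integrable (fun θ ↦ exp (t * f θ)) (uniformSphere (volume : Measure E)) :=
    integrable_uniformSphere_of_continuous (by have := hf.continuous; fun_prop)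
  refine ⟨hint, fun t ↦ ?_⟩
  set m := ∫ x, ‖x‖ ∂stdGaussian E
  have hn : (0 : ℝ) < Module.finrank ℝ E := Nat.cast_pos.2 Module.finrank_pos
  have hm : √(Module.finrank ℝ E * (2 / π)) ≤ m := sqrt_le_integral_norm_stdGaussian
  have hm0 : 0 < m := hm.trans_lt' (by positivity)
  have hscale (θ : Metric.sphere (0 : E) 1) : t / m * (m * f θ) = t * f θ := by
    rw [← mul_assoc, div_mul_cancel₀ t hm0.ne']
  have hexp := lintegral_exp_uniformSphere_le hf hmean (t / m)
  change ∫⁻ θ, ENNReal.ofReal (exp (t / m * (m * f θ))) ∂_ ≤ _ at hexp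
  simp only [hscale] at hexp
  rw [← ofReal_integral_eq_lintegral_ofReal (hint t) (ae_of_all _ fun θ ↦ (exp_pos _).le),
    ENNReal.ofReal_le_ofReal_iff (exp_pos _).le] at hexp
  refine hexp.trans (exp_le_exp.2 ?_)
  rw [coe_toNNReal _ (by positivity)]
  calc 2 * (t / m) ^ 2 * π ^ 2 * K ^ 2 = 2 * t ^ 2 * π ^ 2 * K ^ 2 / m ^ 2 := by ring
    _ ≤ 2 * t ^ 2 * π ^ 2 * K ^ 2 / (Module.finrank ℝ E * (2 / π)) := by
        gcongr
        exact (sqrt_le_left hm0.le).1 hm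
    _ = 2 * π ^ 3 * K ^ 2 / Module.finrank ℝ E * t ^ 2 / 2 := by
        field_simp

theorem measureReal_uniformSphere_le_abs_sub_integral (hf : LipschitzWith K f) {τ : ℝ}
    (hτ : 0 ≤ τ) :
    (uniformSphere (volume : Measure E)).real
        {θ | τ ≤ |f θ - ∫ η, f η ∂uniformSphere (volume : Measure E)|} ≤
      2 * exp (-(1 / (4 * π ^ 3)) * (Module.finrank ℝ E * τ ^ 2 / K ^ 2)) := by
  set σ := uniformSphere (volume : Measure E)
  set g := fun θ ↦ f θ - ∫ η, f η ∂σ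
  have hfi : Integrable f σ := integrable_uniformSphere_of_continuous hf.continuous
  have hsub := hasSubgaussianMGF_uniformSphere (f := g)
    (by simpa using hf.sub (.const (∫ η, f η ∂σ)))
    (by simp [g, σ, integral_sub hfi (integrable_const _)])
  have hn : (0 : ℝ) < Module.finrank ℝ E := Nat.cast_pos.2 Module.finrank_pos
  calc σ.real {θ | τ ≤ |g θ|} ≤ σ.real ({θ | τ ≤ g θ} ∪ {θ | τ ≤ (-g) θ}) :=
        measureReal_mono fun θ (hθ : τ ≤ |g θ|) ↦ le_abs.1 hθ
    _ ≤ σ.real {θ | τ ≤ g θ} + σ.real {θ | τ ≤ (-g) θ} := measureReal_union_le _ _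
    _ ≤ _ := add_le_add (hsub.measure_ge_le hτ) (hsub.neg.measure_ge_le hτ)
    _ = _ := by
        rw [← two_mul, coe_toNNReal _ (by positivity)]
        congr 2
        field_simp
        ring

theorem isLevyConstant : IsLevyConstant (1 / (4 * π ^ 3)) := by
  intro M hM f L τ hL hτ hf
  have : Nonempty (Fin M) := ⟨⟨0, hM⟩⟩
  have hfL : LipschitzWith ⟨L, hL.le⟩ f := LipschitzWith.of_dist_le_mul hf
  have htail := measureReal_uniformSphere_le_abs_sub_integral hfL hτ.le
  rwa [finrank_euclideanSpace_fin] at htail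

end SphereConcentration

section TraceNorm

open scoped InnerProductSpace ComplexOrder

variable {H : Type*} [NormedAddCommGroup H] [InnerProductSpace ℂ H]

lemma tr_add (A B : Op H) : tr (A + B) = tr A + tr B := by simp [tr]

lemma tr_smul (c : ℂ) (A : Op H) : tr (c • A) = c * tr A := by simp [tr]

lemma tr_mul_comm (A B : Op H) : tr (A * B) = tr (B * A) :=
  LinearMap.trace_mul_comm ℂ (A : H →ₗ[ℂ] H) (B : H →ₗ[ℂ] H)

lemma tr_sum {X : Type*} (s : Finset X) (A : X → Op H) : tr (∑ x ∈ s, A x) = ∑ x ∈ s, tr (A x) := by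
  simp [tr, ContinuousLinearMap.toLinearMap_sum]

lemma tr_eq_sum_inner {ι : Type*} [Fintype ι] (e : OrthonormalBasis ι ℂ H) (A : Op H) :
    tr A = ∑ i, ⟪e i, A (e i)⟫_ℂ :=
  LinearMap.trace_eq_sum_inner _ e

lemma tr_nonneg {A : Op H} (hA : 0 ≤ A) : 0 ≤ tr A :=
  (ContinuousLinearMap.nonneg_iff_isPositive A).1 hA |>.toLinearMap.trace_nonneg

variable [CompleteSpace H]

lemma tr_mul_nonneg {A B : Op H} (hA : 0 ≤ A) (hB : 0 ≤ B) : 0 ≤ tr (A * B) := by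
  rw [← CFC.sqrt_mul_sqrt_self B hB, ← mul_assoc, tr_mul_comm, ← mul_assoc]
  exact tr_nonneg ((IsSelfAdjoint.of_nonneg (CFC.sqrt_nonneg B)).conjugate_nonneg hA)

lemma traceNorm_of_nonneg {A : Op H} (hA : 0 ≤ A) : traceNorm A = (tr A).re := by
  rw [traceNorm, (IsSelfAdjoint.of_nonneg hA).star_eq, CFC.sqrt_mul_self A hA]

lemma traceNorm_apply_le_of_isState {G : SuperOp H} {C : ℝ} (hC : 0 ≤ C)
    (hG : inducedOneNorm G ≤ ENNReal.ofReal C) {ρ : Op H} (hρ : IsState ρ) :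
    traceNorm (G ρ) ≤ C := by
  have ρ_ne_zero : ρ ≠ 0 := by
    rintro rfl
    simpa [tr] using hρ.2
  have traceNorm_eq_one : traceNorm ρ = 1 := by
    rw [traceNorm_of_nonneg hρ.1, hρ.2, Complex.one_re]
  have h := (le_iSup₂ (f := fun (A : Op H) (_ : A ≠ 0) ↦
    ENNReal.ofReal (traceNorm (G A) / traceNorm A)) ρ ρ_ne_zero).trans hG
  rwa [traceNorm_eq_one, div_one, ENNReal.ofReal_le_ofReal_iff hC] at h

variable [FiniteDimensional ℂ H]

lemma exists_apply_eigenbasis_eq_smul {A : Op H} (hA : IsSelfAdjoint A) :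
    ∃ (e : OrthonormalBasis (Fin (Module.finrank ℂ H)) ℂ H)
      (l : Fin (Module.finrank ℂ H) → ℝ), ∀ i, A (e i) = (l i : ℂ) • e i :=
  ⟨hA.isSymmetric.eigenvectorBasis rfl, hA.isSymmetric.eigenvalues rfl,
    hA.isSymmetric.apply_eigenvectorBasis rfl⟩

lemma exists_singularValueDecomposition (A : Op H) :
    ∃ e f : OrthonormalBasis (Fin (Module.finrank ℂ H)) ℂ H,
      (∀ i, A (e i) = (‖A (e i)‖ : ℂ) • f i) ∧ traceNorm A = ∑ i, ‖A (e i)‖ := by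
  set P := CFC.sqrt (star A * A) with hP
  have hP₀ : 0 ≤ P := CFC.sqrt_nonneg _
  obtain ⟨e, l, he⟩ := exists_apply_eigenbasis_eq_smul (IsSelfAdjoint.of_nonneg hP₀)
  have inner_apply (i j) : ⟪A (e i), A (e j)⟫_ℂ = l j ^ 2 * ⟪e i, e j⟫_ℂ := by
    have hPP : (star A * A) (e j) = (l j : ℂ) ^ 2 • e j := by
      rw [← CFC.sqrt_mul_sqrt_self _ (star_mul_self_nonneg A), ← hP,
        mul_apply_eq_comp, he, map_smul, he, smul_smul, sq]
    rw [← ContinuousLinearMap.adjoint_inner_right, ← ContinuousLinearMap.star_eq_adjoint,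
      ← mul_apply_eq_comp, hPP, inner_smul_right]
  have l_nonneg (i) : 0 ≤ l i := by
    have h := ((ContinuousLinearMap.nonneg_iff_isPositive P).1 hP₀).re_inner_nonneg_right (e i)
    simpa [he, inner_smul_right] using h
  have norm_apply (i) : ‖A (e i)‖ = l i := by
    rw [← sq_eq_sq₀ (norm_nonneg _) (l_nonneg i)]
    have h : (‖A (e i)‖ : ℂ) ^ 2 = (l i : ℂ) ^ 2 := by
      simpa [inner_self_eq_norm_sq_to_K] using inner_apply i i
    exact_mod_cast h
  have orthogonal : Pairwise fun i j ↦ ⟪A (e i), A (e j)⟫_ℂ = 0 := fun i j hij ↦ by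
    beta_reduce
    rw [inner_apply, e.inner_eq_zero hij, mul_zero]
  refine ⟨e, InnerProductSpace.gramSchmidtOrthonormalBasis (by simp) fun i ↦ A (e i),
    fun i ↦ ?_, ?_⟩
  · by_cases hi : A (e i) = 0
    · simp [hi]
    · rw [InnerProductSpace.gramSchmidtOrthonormalBasis_apply_of_orthogonal _ orthogonal hi]
      simp [smul_smul, hi]
  · rw [traceNorm, ← hP, tr_eq_sum_inner e, Complex.re_sum]
    simp [he, norm_apply]

lemma sum_norm_inner_apply_le_traceNorm {ι : Type*} [Fintype ι] (g h : OrthonormalBasis ι ℂ H)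
    (A : Op H) : ∑ i, ‖⟪g i, A (h i)⟫_ℂ‖ ≤ traceNorm A := by
  obtain ⟨e, f, hA, htr⟩ := exists_singularValueDecomposition A
  have expand (i) : ⟪g i, A (h i)⟫_ℂ = ∑ k, ⟪e k, h i⟫_ℂ * (‖A (e k)‖ * ⟪g i, f k⟫_ℂ) := by
    conv_lhs => rw [← e.sum_repr' (h i)]
    simp only [map_sum, map_smul, inner_sum, inner_smul_right]
    refine Finset.sum_congr rfl fun k _ ↦ ?_
    conv_lhs => rw [hA, inner_smul_right]
  have cauchySchwarz (k) : ∑ i, ‖⟪e k, h i⟫_ℂ‖ * ‖⟪g i, f k⟫_ℂ‖ ≤ 1 := by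
    have := Real.sum_mul_le_sqrt_mul_sqrt Finset.univ (fun i ↦ ‖⟪e k, h i⟫_ℂ‖)
      (fun i ↦ ‖⟪g i, f k⟫_ℂ‖)
    simpa [h.sum_sq_norm_inner_left, g.sum_sq_norm_inner_right] using this
  calc ∑ i, ‖⟪g i, A (h i)⟫_ℂ‖
      ≤ ∑ i, ∑ k, ‖A (e k)‖ * (‖⟪e k, h i⟫_ℂ‖ * ‖⟪g i, f k⟫_ℂ‖) :=
        Finset.sum_le_sum fun i _ ↦ by
          rw [expand]
          refine (norm_sum_le _ _).trans_eq (Finset.sum_congr rfl fun k _ ↦ ?_)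
          rw [norm_mul, norm_mul, Complex.norm_real, norm_norm, mul_left_comm]
    _ = ∑ k, ‖A (e k)‖ * ∑ i, ‖⟪e k, h i⟫_ℂ‖ * ‖⟪g i, f k⟫_ℂ‖ := by
        simp_rw [Finset.mul_sum]
        exact Finset.sum_comm
    _ ≤ ∑ k, ‖A (e k)‖ := Finset.sum_le_sum fun k _ ↦
        mul_le_of_le_one_right (norm_nonneg _) (cauchySchwarz k)
    _ = traceNorm A := htr.symm

lemma traceNorm_sum_smul_le {J : Type*} (s : Finset J) (c : J → ℂ) (B : J → Op H) :
    traceNorm (∑ j ∈ s, c j • B j) ≤ ∑ j ∈ s, ‖c j‖ * traceNorm (B j) := by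
  set A := ∑ j ∈ s, c j • B j
  obtain ⟨e, f, hA, htr⟩ := exists_singularValueDecomposition A
  have norm_apply (i) : ‖A (e i)‖ = ‖⟪f i, A (e i)⟫_ℂ‖ := by
    conv_rhs => rw [hA, inner_smul_right, inner_self_eq_norm_sq_to_K, f.norm_eq_one]
    simp
  have norm_apply_le (i) : ‖A (e i)‖ ≤ ∑ j ∈ s, ‖c j‖ * ‖⟪f i, B j (e i)⟫_ℂ‖ := by
    rw [norm_apply]
    simp only [A, sum_apply, smul_apply, inner_sum, inner_smul_right]
    exact (norm_sum_le _ _).trans_eq (by simp only [norm_mul])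
  calc traceNorm A = ∑ i, ‖A (e i)‖ := htr
    _ ≤ ∑ i, ∑ j ∈ s, ‖c j‖ * ‖⟪f i, B j (e i)⟫_ℂ‖ := Finset.sum_le_sum fun i _ ↦ norm_apply_le i
    _ = ∑ j ∈ s, ‖c j‖ * ∑ i, ‖⟪f i, B j (e i)⟫_ℂ‖ := by
        simp_rw [Finset.mul_sum]
        exact Finset.sum_comm
    _ ≤ ∑ j ∈ s, ‖c j‖ * traceNorm (B j) := Finset.sum_le_sum fun j _ ↦
        mul_le_mul_of_nonneg_left (sum_norm_inner_apply_le_traceNorm f e (B j)) (norm_nonneg _)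

end TraceNorm

section Measurement

open scoped InnerProductSpace ComplexOrder ComplexStarModule

variable {H : Type*} [NormedAddCommGroup H] [InnerProductSpace ℂ H]

/-- `T` is positive and trace preserving, as the trace-norm contraction of a channel requires. -/
def IsPTP (T : SuperOp H) : Prop :=
  (∀ A, 0 ≤ A → 0 ≤ T A) ∧ ∀ A, tr (T A) = tr A

lemma IsPTP.isState_apply {T : SuperOp H} (hT : IsPTP T) {ρ : Op H} (hρ : IsState ρ) :
    IsState (T ρ) :=
  ⟨hT.1 ρ hρ.1, (hT.2 ρ).trans hρ.2⟩

lemma IsCPTP.isPTP [CompleteSpace H] {T : SuperOp H} (hT : IsCPTP T) : IsPTP T := by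
  obtain ⟨⟨Φ, hΦ⟩, htr⟩ := hT
  refine ⟨fun A hA ↦ ?_, htr⟩
  rw [← hΦ]
  exact map_nonneg Φ hA

lemma im_tr_mul_apply_eq_zero [CompleteSpace H] {T : SuperOp H} (hT : ∀ A, 0 ≤ A → 0 ≤ T A)
    {B : Op H} (hB : 0 ≤ B) {A : Op H} (hA : IsSelfAdjoint A) : (tr (B * T A)).im = 0 := by
  have im_eq_zero {A : Op H} (hA : 0 ≤ A) : (tr (B * T A)).im = 0 :=
    (Complex.nonneg_iff.1 (tr_mul_nonneg hB (hT A hA))).2.symm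
  rw [← CFC.posPart_sub_negPart A hA, map_sub, mul_sub, sub_eq_add_neg, tr_add, ← neg_one_smul ℂ,
    tr_smul]
  simp [im_eq_zero (CFC.posPart_nonneg A), im_eq_zero (CFC.negPart_nonneg A)]

variable [FiniteDimensional ℂ H] {X : Type*} [Fintype X]

/-- The outcome statistics `A ↦ (re Tr(E_x A))_x` of a family of effects `E`, with values in
`ℓ¹(X)`, so that the `ℓ¹`-distance between outcome distributions is a norm. -/
def outcomeMap (E : X → Op H) : Op H →L[ℝ] PiLp 1 fun _ : X ↦ ℝ :=
  have : FiniteDimensional ℝ (Op H) := FiniteDimensional.complexToReal _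
  LinearMap.toContinuousLinearMap
    { toFun := fun A ↦ WithLp.toLp 1 fun x ↦ (tr (E x * A)).re
      map_add' := fun A B ↦ by
        ext x
        simp [mul_add, tr_add]
      map_smul' := fun r A ↦ by
        ext x
        simp [← Complex.coe_smul, tr_smul] }

lemma outcomeMap_apply (E : X → Op H) (A : Op H) (x : X) :
    outcomeMap E A x = (tr (E x * A)).re := rfl

lemma norm_outcomeMap_apply (E : X → Op H) (A : Op H) :
    ‖outcomeMap E A‖ = ∑ x, |(tr (E x * A)).re| :=
  PiLp.norm_eq_of_L1 _

variable [CompleteSpace H] {E : X → Op H}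

lemma norm_outcomeMap_apply_of_nonneg (hE : IsPOVM E) {A : Op H} (hA : 0 ≤ A) :
    ‖outcomeMap E A‖ = (tr A).re := by
  have re_nonneg (x) : 0 ≤ (tr (E x * A)).re :=
    (Complex.nonneg_iff.1 (tr_mul_nonneg (hE.1 x) hA)).1
  simp_rw [norm_outcomeMap_apply, abs_of_nonneg (re_nonneg _)]
  rw [← Complex.re_sum, ← tr_sum, ← Finset.sum_mul, hE.2, one_mul]

lemma outcomeMap_apply_realPart (hE : IsPOVM E) {T : SuperOp H} (hT : ∀ A, 0 ≤ A → 0 ≤ T A)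
    (A : Op H) : outcomeMap E (T (ℜ A : Op H)) = outcomeMap E (T A) := by
  ext x
  conv_rhs => rw [← realPart_add_I_smul_imaginaryPart A]
  rw [map_add, map_smul, outcomeMap_apply, outcomeMap_apply, mul_add, mul_smul_comm, tr_add,
    tr_smul, Complex.add_re, Complex.I_mul_re,
    im_tr_mul_apply_eq_zero hT (hE.1 x) (ℑ A).2, neg_zero, add_zero]

lemma norm_outcomeMap_apply_le_traceNorm (hE : IsPOVM E) {T : SuperOp H} (hT : IsPTP T)
    (A : Op H) : ‖outcomeMap E (T A)‖ ≤ traceNorm A := by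
  obtain ⟨e, l, he⟩ := exists_apply_eigenbasis_eq_smul (ℜ A).2
  set R := fun i ↦ InnerProductSpace.rankOne ℂ (e i) (e i)
  have decomposition : (ℜ A : Op H) = ∑ i, l i • R i := by
    refine ContinuousLinearMap.coe_injective (e.toBasis.ext fun i ↦ ?_)
    simp [he, R, e.inner_eq_ite]
  have norm_le_one (i) : ‖outcomeMap E (T (R i))‖ ≤ 1 := by
    have hR : 0 ≤ R i := (ContinuousLinearMap.nonneg_iff_isPositive _).2
      (InnerProductSpace.isPositive_rankOne_self _)
    rw [norm_outcomeMap_apply_of_nonneg hE (hT.1 _ hR), hT.2, tr,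
      InnerProductSpace.trace_rankOne, inner_self_eq_norm_sq_to_K, e.norm_eq_one]
    simp
  have eigenvalue_eq (i) : l i = (⟪e i, A (e i)⟫_ℂ).re := by
    have him : (⟪e i, (ℑ A : Op H) (e i)⟫_ℂ).im = 0 := (ℑ A).2.isSymmetric.im_inner_self_apply _
    conv_rhs => rw [← realPart_add_I_smul_imaginaryPart A]
    simp [he, him]
  calc ‖outcomeMap E (T A)‖ = ‖∑ i, l i • outcomeMap E (T (R i))‖ := by
        rw [← outcomeMap_apply_realPart hE hT.1, decomposition]
        simp_rw [map_sum, ← Complex.coe_smul, map_smul, Complex.coe_smul, map_smul]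
    _ ≤ ∑ i, |l i| := norm_sum_le_of_le _ fun i _ ↦ by
        rw [norm_smul, Real.norm_eq_abs]
        exact mul_le_of_le_one_right (abs_nonneg _) (norm_le_one i)
    _ ≤ ∑ i, ‖⟪e i, A (e i)⟫_ℂ‖ := Finset.sum_le_sum fun i _ ↦ by
        rw [eigenvalue_eq]
        exact Complex.abs_re_le_norm _
    _ ≤ traceNorm A := sum_norm_inner_apply_le_traceNorm e e A

end Measurement

section Perturbation

variable {H : Type*} [NormedAddCommGroup H] [InnerProductSpace ℂ H] [CompleteSpace H]

lemma evolution_zero (L : SuperOp H) : evolution L 0 = 1 := by simp [evolution]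

lemma hasDerivAt_evolution (L : SuperOp H) (s : ℝ) :
    HasDerivAt (evolution L) (L * evolution L s) s := by
  have h := (hasDerivAt_exp_smul_const' L (s : ℂ)).scomp s Complex.ofRealCLM.hasDerivAt
  rwa [Complex.ofRealCLM_apply, Complex.ofReal_one, one_smul] at h

lemma hasDerivAt_evolution' (L : SuperOp H) (s : ℝ) :
    HasDerivAt (evolution L) (evolution L s * L) s := by
  have h := (hasDerivAt_exp_smul_const L (s : ℂ)).scomp s Complex.ofRealCLM.hasDerivAt
  rwa [Complex.ofRealCLM_apply, Complex.ofReal_one, one_smul] at h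

lemma hasDerivAt_evolution_sub_mul_evolution (L L' : SuperOp H) (t s : ℝ) :
    HasDerivAt (fun s ↦ evolution L (t - s) * evolution L' s)
      (evolution L (t - s) * (L' - L) * evolution L' s) s := by
  have hL : HasDerivAt (fun s ↦ evolution L (t - s)) (-(evolution L (t - s) * L)) s := by
    simpa using! (hasDerivAt_evolution' L (t - s)).scomp s ((hasDerivAt_id s).const_sub t)
  exact (hL.mul (hasDerivAt_evolution L' s)).congr_deriv (by noncomm_ring)

variable [FiniteDimensional ℂ H] {X : Type*} [Fintype X]

lemma sum_abs_outputDist_sub_le {E : X → Op H} (hE : IsPOVM E) {L L' : SuperOp H}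
    (hL : ∀ s, 0 ≤ s → IsPTP (evolution L s)) (hL' : ∀ s, 0 ≤ s → IsPTP (evolution L' s))
    {ρ : Op H} (hρ : IsState ρ) {t : ℝ} (ht : 0 ≤ t) {K : ℝ}
    (hK : ∀ σ, IsState σ → traceNorm ((L' - L) σ) ≤ K) :
    ∑ x, |outputDist t ρ E L' x - outputDist t ρ E L x| ≤ K * t := by
  have hasDerivAt (s) : HasDerivAt
      (fun s ↦ outcomeMap E (evolution L (t - s) (evolution L' s ρ)))
      (outcomeMap E (evolution L (t - s) ((L' - L) (evolution L' s ρ)))) s :=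
    ((outcomeMap E).comp ((ContinuousLinearMap.apply ℂ (Op H) ρ).restrictScalars ℝ)
      ).hasFDerivAt.comp_hasDerivAt s (hasDerivAt_evolution_sub_mul_evolution L L' t s)
  have norm_deriv_le : ∀ s ∈ Set.Ico 0 t,
      ‖outcomeMap E (evolution L (t - s) ((L' - L) (evolution L' s ρ)))‖ ≤ K := fun s hs ↦
    (norm_outcomeMap_apply_le_traceNorm hE (hL _ (sub_nonneg.2 hs.2.le)) _).trans
      (hK _ ((hL' s hs.1).isState_apply hρ))
  have h := norm_image_sub_le_of_norm_deriv_le_segment'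
    (fun s _ ↦ (hasDerivAt s).hasDerivWithinAt) norm_deriv_le t ⟨ht, le_rfl⟩
  simpa [evolution_zero, PiLp.norm_eq_of_L1, outcomeMap_apply, outputDist] using h

lemma abs_dTV_sub_dTV_le (P P' Q : X → ℝ) :
    |dTV P Q - dTV P' Q| ≤ (1 / 2) * ∑ x, |P x - P' x| := by
  rw [dTV, dTV, ← mul_sub, abs_mul, ← Finset.sum_sub_distrib, abs_of_pos one_half_pos]
  gcongr
  refine (Finset.abs_sum_le_sum_abs _ _).trans (Finset.sum_le_sum fun x _ ↦ ?_)
  exact (abs_abs_sub_abs_le_abs_sub _ _).trans_eq (by rw [sub_sub_sub_cancel_right])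

variable {M : ℕ}

lemma one_le_of_paramSphere (θ : ParamSphere M) : 1 ≤ M := by
  rw [Nat.one_le_iff_ne_zero]
  rintro rfl
  exact ne_zero_of_mem_unit_sphere θ (Subsingleton.elim _ _)

lemma traceNorm_generator_sub_apply_le (Lref : SuperOp H) {G : Fin M → SuperOp H} {δ C : ℝ}
    (hδ : 0 ≤ δ) (hC : 0 ≤ C) (hG : ∀ j, inducedOneNorm (G j) ≤ ENNReal.ofReal C)
    (θ θ' : ParamSphere M) {σ : Op H} (hσ : IsState σ) :
    traceNorm ((generator Lref G δ θ - generator Lref G δ θ') σ) ≤ δ * C * dist θ θ' := by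
  set u : EuclideanSpace ℝ (Fin M) := θ - θ'
  have hM : 0 < √(M : ℝ) := Real.sqrt_pos.2 (mod_cast one_le_of_paramSphere θ)
  have difference_eq : (generator Lref G δ θ - generator Lref G δ θ') σ =
      ∑ j, ((δ / √M * u j : ℝ) : ℂ) • G j σ := by
    simp [generator, u, Finset.smul_sum, mul_smul, smul_sub, sub_smul]
  have sum_abs_le : ∑ j, |u j| ≤ √M * dist θ θ' := by
    simpa [u, Subtype.dist_eq, dist_eq_norm, EuclideanSpace.inner_single_left] using
      sum_abs_inner_le_sqrt_card_mul_norm (EuclideanSpace.basisFun (Fin M) ℝ) u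
  calc traceNorm ((generator Lref G δ θ - generator Lref G δ θ') σ)
      ≤ ∑ j, ‖((δ / √M * u j : ℝ) : ℂ)‖ * traceNorm (G j σ) := by
        rw [difference_eq]
        exact traceNorm_sum_smul_le _ _ _
    _ ≤ ∑ j, δ / √M * |u j| * C := Finset.sum_le_sum fun j _ ↦ by
        rw [Complex.norm_real, Real.norm_eq_abs, abs_mul,
          abs_of_nonneg (by positivity : 0 ≤ δ / √M)]
        gcongr
        exact traceNorm_apply_le_of_isState hC (hG j) hσ
    _ = δ / √M * C * ∑ j, |u j| := by
        rw [Finset.mul_sum]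
        exact Finset.sum_congr rfl fun j _ ↦ by ring
    _ ≤ δ / √M * C * (√M * dist θ θ') := by gcongr
    _ = δ * C * dist θ θ' := by field_simp

lemma abs_tvToRef_sub_tvToRef_le {Lref : SuperOp H} {G : Fin M → SuperOp H} {δ t C : ℝ}
    (hδ : 0 ≤ δ) (ht : 0 ≤ t) (hC : 0 ≤ C) (hG : ∀ j, inducedOneNorm (G j) ≤ ENNReal.ofReal C)
    {ρ : Op H} (hρ : IsState ρ) {E : X → Op H} (hE : IsPOVM E) (Q : X → ℝ) {θ θ' : ParamSphere M}
    (hθ : ∀ s, 0 ≤ s → IsPTP (evolution (generator Lref G δ θ) s))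
    (hθ' : ∀ s, 0 ≤ s → IsPTP (evolution (generator Lref G δ θ') s)) :
    |tvToRef Lref G δ t ρ E Q θ - tvToRef Lref G δ t ρ E Q θ'| ≤
      (t * δ * C / 2) * dist θ θ' :=
  calc |tvToRef Lref G δ t ρ E Q θ - tvToRef Lref G δ t ρ E Q θ'|
      ≤ (1 / 2) * ∑ x, |outputDist t ρ E (generator Lref G δ θ) x -
          outputDist t ρ E (generator Lref G δ θ') x| := abs_dTV_sub_dTV_le _ _ _
    _ ≤ (1 / 2) * (δ * C * dist θ θ' * t) := by
        gcongr
        exact sum_abs_outputDist_sub_le hE hθ' hθ hρ ht fun σ hσ ↦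
          traceNorm_generator_sub_apply_le Lref hδ hC hG θ θ' hσ
    _ = (t * δ * C / 2) * dist θ θ' := by ring

end Perturbation

section Concentration

variable {M : ℕ}

lemma isProbabilityMeasure_sphereMeasure (hM : 1 ≤ M) :
    IsProbabilityMeasure (sphereMeasure M) :=
  have : Nonempty (Fin M) := ⟨⟨0, hM⟩⟩
  inferInstanceAs <| IsProbabilityMeasure <|
    uniformSphere (volume : Measure (EuclideanSpace ℝ (Fin M)))

variable {Θ : Set (ParamSphere M)}

lemma paramMeasure_eq_sphereMeasure (hM : 1 ≤ M) (hΘ : ∀ᵐ θ ∂sphereMeasure M, θ ∈ Θ) :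
    paramMeasure Θ = sphereMeasure M := by
  have := isProbabilityMeasure_sphereMeasure hM
  have measure_eq_one : sphereMeasure M Θ = 1 :=
    (measure_congr (Filter.eventuallyEq_univ.2 hΘ)).trans measure_univ
  rw [paramMeasure, measure_eq_one, inv_one, one_smul, Measure.restrict_eq_self_of_ae_mem hΘ]

lemma IsLevyConstant.measureReal_paramMeasure_le {c : ℝ} (hc : IsLevyConstant c)
    (hne : Θ.Nonempty) (hΘ : ∀ᵐ θ ∂sphereMeasure M, θ ∈ Θ)
    {f : ParamSphere M → ℝ} {L : ℝ} (hL : 0 < L)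
    (hf : ∀ θ ∈ Θ, ∀ θ' ∈ Θ, |f θ - f θ'| ≤ L * dist θ θ') {m₀ ε : ℝ}
    (hmean : ∫ θ, f θ ∂paramMeasure Θ ∈ Set.Icc (m₀ - ε) (m₀ + ε)) {ξ : ℝ} (hξ : 0 < ξ) :
    (paramMeasure Θ).real {θ | ξ + ε ≤ |f θ - m₀|} ≤
      2 * Real.exp (-c * (M * ξ ^ 2 / L ^ 2)) := by
  have hM : 1 ≤ M := one_le_of_paramSphere hne.some
  have := isProbabilityMeasure_sphereMeasure hM
  rw [paramMeasure_eq_sphereMeasure hM hΘ] at hmean ⊢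
  have lipschitzOn : LipschitzOnWith L.toNNReal f Θ :=
    LipschitzOnWith.of_dist_le_mul fun θ hθ θ' hθ' ↦ by
      rw [Real.coe_toNNReal _ hL.le, Real.dist_eq]
      exact hf θ hθ θ' hθ'
  obtain ⟨g, hg, hfg⟩ := lipschitzOn.extend_real
  have ae_eq : f =ᵐ[sphereMeasure M] g := hΘ.mono hfg
  rw [integral_congr_ae ae_eq] at hmean
  have mean_close : |∫ η, g η ∂sphereMeasure M - m₀| ≤ ε := abs_sub_le_iff.2
    ⟨by linarith [hmean.2], by linarith [hmean.1]⟩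
  have levy := hc M hM g L ξ hL hξ fun θ θ' ↦ by
    simpa [Real.dist_eq, hL.le] using hg.dist_le_mul θ θ'
  calc (sphereMeasure M).real {θ | ξ + ε ≤ |f θ - m₀|}
      = (sphereMeasure M).real {θ | ξ + ε ≤ |g θ - m₀|} :=
        measureReal_congr (Filter.eventuallyEq_set.2 (ae_eq.mono fun θ hθ ↦ by simp [hθ]))
    _ ≤ (sphereMeasure M).real {θ | ξ ≤ |g θ - ∫ η, g η ∂sphereMeasure M|} :=
        measureReal_mono fun θ (hθ : ξ + ε ≤ |g θ - m₀|) ↦ by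
          have := abs_sub_le (g θ) (∫ η, g η ∂sphereMeasure M) m₀
          simp only [Set.mem_ofPred_eq]
          linarith
    _ ≤ 2 * Real.exp (-c * (M * ξ ^ 2 / L ^ 2)) := levy

lemma setOf_le_half_subset {α : Type*} (f : α → ℝ) (m₀ : ℝ) :
    {a | f a ≤ m₀ / 2} ⊆ {a | m₀ / 2 ≤ |f a - m₀|} :=
  fun a (ha : f a ≤ m₀ / 2) ↦ by
    rw [Set.mem_ofPred_eq, le_abs]
    right
    linarith

lemma IsLevyConstant.measureReal_paramMeasure_le_half {c : ℝ} (hc : IsLevyConstant c)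
    (hne : Θ.Nonempty) (hΘ : ∀ᵐ θ ∂sphereMeasure M, θ ∈ Θ)
    {f : ParamSphere M → ℝ} {L : ℝ} (hL : 0 < L)
    (hf : ∀ θ ∈ Θ, ∀ θ' ∈ Θ, |f θ - f θ'| ≤ L * dist θ θ') {m₀ ε : ℝ} (hm₀ : 0 < m₀)
    (hmean : ∫ θ, f θ ∂paramMeasure Θ ∈ Set.Icc (m₀ - ε) (m₀ + ε)) (hε : ε ≤ m₀ / 4) :
    (paramMeasure Θ).real {θ | f θ ≤ m₀ / 2} ≤
      2 * Real.exp (-c * (M * m₀ ^ 2 / (16 * L ^ 2))) := by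
  have hM : 1 ≤ M := one_le_of_paramSphere hne.some
  have : IsProbabilityMeasure (paramMeasure Θ) :=
    paramMeasure_eq_sphereMeasure hM hΘ ▸ isProbabilityMeasure_sphereMeasure hM
  calc (paramMeasure Θ).real {θ | f θ ≤ m₀ / 2}
      ≤ (paramMeasure Θ).real {θ | m₀ / 4 + ε ≤ |f θ - m₀|} :=
        measureReal_mono <| (setOf_le_half_subset f m₀).trans fun θ hθ ↦
          (by linarith : m₀ / 4 + ε ≤ m₀ / 2).trans hθ
    _ ≤ 2 * Real.exp (-c * (M * (m₀ / 4) ^ 2 / L ^ 2)) :=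
        hc.measureReal_paramMeasure_le hne hΘ hL hf hmean (by positivity)
    _ = 2 * Real.exp (-c * (M * m₀ ^ 2 / (16 * L ^ 2))) := by
        congr 3
        field_simp
        norm_num

end Concentration

end OpenSystem

end

open OpenSystem in
theorem mainTheorem6_general {c : ℝ} (hc : IsLevyConstant c)
    {H : Type*} [NormedAddCommGroup H] [InnerProductSpace ℂ H] [FiniteDimensional ℂ H]
    [CompleteSpace H] {X : Type*} [Fintype X] {M : ℕ} {Lref : SuperOp H} {G : Fin M → SuperOp H}
    {δ t C_G : ℝ} {Θ : Set (ParamSphere M)} {ρ : Op H} {E : X → Op H} (Q : X → ℝ)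
    (hδ : 0 < δ) (ht : 0 < t) (hC : 0 < C_G) (hne : Θ.Nonempty)
    (hΘ : ∀ θ ∈ Θ, ∀ s, 0 ≤ s → IsPTP (evolution (generator Lref G δ θ) s))
    (hG : ∀ j, inducedOneNorm (G j) ≤ ENNReal.ofReal C_G) (hρ : IsState ρ) (hE : IsPOVM E) :
    (∀ θ ∈ Θ, ∀ θ' ∈ Θ,
      |tvToRef Lref G δ t ρ E Q θ - tvToRef Lref G δ t ρ E Q θ'|
        ≤ (t * δ * C_G / 2) * dist θ θ') ∧
    ∀ m₀ ε : ℝ, 0 < m₀ →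
      (∀ᵐ θ ∂sphereMeasure M, θ ∈ Θ) →
      (∫ θ, tvToRef Lref G δ t ρ E Q θ ∂paramMeasure Θ) ∈ Set.Icc (m₀ - ε) (m₀ + ε) →
      (∀ ξ : ℝ, 0 < ξ →
        (paramMeasure Θ).real {θ | ξ + ε ≤ |tvToRef Lref G δ t ρ E Q θ - m₀|}
          ≤ 2 * Real.exp (-c * (M * ξ ^ 2 / (t * δ * C_G / 2) ^ 2))) ∧
      (ε ≤ m₀ / 4 →
        {θ | tvToRef Lref G δ t ρ E Q θ ≤ m₀ / 2}
          ⊆ {θ | m₀ / 2 ≤ |tvToRef Lref G δ t ρ E Q θ - m₀|} ∧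
        (paramMeasure Θ).real {θ | tvToRef Lref G δ t ρ E Q θ ≤ m₀ / 2}
          ≤ 2 * Real.exp (-c * (M * m₀ ^ 2 / (16 * (t * δ * C_G / 2) ^ 2)))) := by
  have lipschitz : ∀ θ ∈ Θ, ∀ θ' ∈ Θ,
      |tvToRef Lref G δ t ρ E Q θ - tvToRef Lref G δ t ρ E Q θ'|
        ≤ (t * δ * C_G / 2) * dist θ θ' := fun θ hθ θ' hθ' ↦
    abs_tvToRef_sub_tvToRef_le hδ.le ht.le hC.le hG hρ hE Q (hΘ θ hθ) (hΘ θ' hθ')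
  have hL : 0 < t * δ * C_G / 2 := by positivity
  exact ⟨lipschitz, fun m₀ ε hm₀ hae hmean ↦
    ⟨fun ξ hξ ↦ hc.measureReal_paramMeasure_le hne hae hL lipschitz hmean hξ,
      fun hε ↦ ⟨setOf_le_half_subset _ m₀,
        hc.measureReal_paramMeasure_le_half hne hae hL lipschitz hm₀ hmean hε⟩⟩⟩

theorem mainTheorem6 :
    ∃ c_par : ℝ, 0 < c_par ∧ OpenSystem.IsLevyConstant c_par ∧
      ∀ (H : Type*) [NormedAddCommGroup H] [InnerProductSpace ℂ H] [FiniteDimensional ℂ H]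
        [CompleteSpace H] (X : Type*) [Fintype X] (M : ℕ)
        (Lref : OpenSystem.SuperOp H) (G : Fin M → OpenSystem.SuperOp H) (δ t C_G : ℝ)
        (Θ : Set (OpenSystem.ParamSphere M))
        (ρ : OpenSystem.Op H) (E : X → OpenSystem.Op H) (Q : X → ℝ),
        0 < δ → 0 < t → 0 < C_G →
        OpenSystem.IsGKSL Lref →
        Θ.Nonempty →
        (∀ θ ∈ Θ, OpenSystem.IsGKSL (OpenSystem.generator Lref G δ θ)) →
        (∀ j, OpenSystem.inducedOneNorm (G j) ≤ ENNReal.ofReal C_G) →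
        OpenSystem.IsState ρ → OpenSystem.IsPOVM E → Q ∈ stdSimplex ℝ X →
        -- Lipschitz bound on the parameter set, with constant `L_TV = L₀ / 2`, `L₀ = t δ C_G`
        (∀ θ ∈ Θ, ∀ θ' ∈ Θ,
          |OpenSystem.tvToRef Lref G δ t ρ E Q θ - OpenSystem.tvToRef Lref G δ t ρ E Q θ'|
            ≤ (t * δ * C_G / 2) * dist θ θ') ∧
        -- `Θ` of full measure, and the mean assumption
        ∀ m₀ ε : ℝ, 0 < m₀ →
          (∀ᵐ θ ∂OpenSystem.sphereMeasure M, θ ∈ Θ) →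
          (∫ θ, OpenSystem.tvToRef Lref G δ t ρ E Q θ ∂OpenSystem.paramMeasure Θ)
            ∈ Set.Icc (m₀ - ε) (m₀ + ε) →
          -- concentration around `m₀`
          (∀ ξ : ℝ, 0 < ξ →
            (OpenSystem.paramMeasure Θ).real
                {θ | ξ + ε ≤ |OpenSystem.tvToRef Lref G δ t ρ E Q θ - m₀|}
              ≤ 2 * Real.exp (-c_par * (M * ξ ^ 2 / (t * δ * C_G / 2) ^ 2))) ∧
          -- typicality of being far from `Q`
          (ε ≤ m₀ / 4 →
            {θ | OpenSystem.tvToRef Lref G δ t ρ E Q θ ≤ m₀ / 2}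
              ⊆ {θ | m₀ / 2 ≤ |OpenSystem.tvToRef Lref G δ t ρ E Q θ - m₀|} ∧
            (OpenSystem.paramMeasure Θ).real
                {θ | OpenSystem.tvToRef Lref G δ t ρ E Q θ ≤ m₀ / 2}
              ≤ 2 * Real.exp
                  (-c_par * (M * m₀ ^ 2 / (16 * (t * δ * C_G / 2) ^ 2)))) :=
  ⟨1 / (4 * Real.pi ^ 3), by positivity, OpenSystem.isLevyConstant,
    fun _ _ _ _ _ _ _ _ _ _ _ _ _ _ _ _ Q hδ ht hC _ hne hΘ hG hρ hE _ ↦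
      mainTheorem6_general OpenSystem.isLevyConstant Q hδ ht hC hne
        (fun θ hθ s hs ↦ ((hΘ θ hθ).isCPTP_evolution s hs).isPTP) hG hρ hE⟩
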